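/- Let $X$ be a finite domain with $N\ge 1$ elements and let $0<\varepsilon<1$. A quantum call to a function $F:X\to\{0,1\}$ is an application of $|x,c\rangle\mapsto|x,c\oplus F(x)\rangle$; a classical call evaluates $F$ at a point. Consider the following algorithms; only calls to $F$ are counted. In the first three, $F$ stands for the searched function, $\theta_t\in[0,\pi/2]$ is given by $\sin^2\theta_t=t/N$, and a search step runs a circuit, measures an element $i\in X$ and calls $F$ at $i$; it succeeds and returns $i$ if $F(i)=1$. * BBHT: set $m=1$. While $m\le 2\sqrt N$: choose an integer $0\le j<m$ uniformly at random and make a search step with $j$ iterations of Grover's original algorithm; if it succeeds, return the element found, otherwise replace $m$ by $\tfrac87 m$. At the end return *false*. * BCWZ with parameter $\varepsilon^{-1}$: let $t_0=\min(\lceil\lg\varepsilon^{-1}\rceil,N)$. For $t=1,\dots,t_0$ make a search step with the exact version of Grover's algorithm for exactly $t$ solutions: $n=\lceil \pi/(4\theta_t)-\tfrac12\rceil$ iterations of amplitude amplification, where an ancilla qubit lowers the initial success amplitude (for $t$ solutions) from $\sin\theta_t$ to $\sin\frac{\pi}{4n+2}$. Then do the following $t_0$ times: make up to three search steps, each with $j$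 Grover iterations for a fresh uniformly random integer $0\le j<\sqrt{N/t_0}$. Return the element found as soon as a search step succeeds; if none does, return *false*. * findsol with parameter $\varepsilon^{-1}$: run BBHT up to two times, and if neither run finds a solution, run BCWZ with parameter $\varepsilon^{-1}$; return the solution found, or *false* if there is none. * findall with parameter $\varepsilon^{-1}$: start with $H=\emptyset$. Repeatedly run findsol with parameter $\varepsilon^{-1}$ on the function $F'$ with $F'(x)=1$ if and only if $F(x)=1$ and $x\notin H$ (one call to $F'$ makes one call to $F$). If an element is returned, add it to $H$; if *false* is returned, stop and return $H$. Then for every $\varepsilon_0<1$ there is a constant $C>0$, depending only on $\varepsilon_0$, such that for every finite domain with $N\ge1$ elements, every $F$ with exactly $M$ solutions ($0\le M\le N$) of $F(x)=1$, and every $0<\varepsilon\le\varepsilon_0$: findall returns exactly the set $\{x: F(x)=1\}$ except with probability at most $\varepsilon$, and its expected number of calls to $F$ is at most $$C\left(\sqrt{NM}+\sqrt{N\lg\varepsilon^{-1}}\right).$$ -/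

import Mathlib

universe u v w

noncomputable section

namespace QuantumSearch

/-! ### Quantum circuits that call a binary function `F : X → Bool`

The basis states are the triples `(x, b, c)`: `x` is the register that holds an element of the
domain, `b` is an ancilla qubit and `c` is the target qubit of the calls to `F`. -/

/-- The pure states (as unit vectors) live in this space. -/
abbrev State (X : Type u) [Fintype X] : Type u := EuclideanSpace ℂ (X × Bool × Bool)

/-- Unitary operators on the state space. -/
abbrev Gate (X : Type u) [Fintype X] : Type u := State X ≃ₗᵢ[ℂ] State X

/-- The permutation `(x, b, c) ↦ (x, b, c ⊕ g x b)` of the basis states. -/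
def xorPerm {X : Type u} (g : X → Bool → Bool) : Equiv.Perm (X × Bool × Bool) :=
  Function.Involutive.toPerm
    (fun i => (i.1, i.2.1, xor i.2.2 (g i.1 i.2.1)))
    (fun i => by simp)

/-- The unitary `|x, b, c⟩ ↦ |x, b, c ⊕ g x b⟩`. -/
def xorGate {X : Type u} [Fintype X] (g : X → Bool → Bool) : Gate X :=
  LinearIsometryEquiv.piLpCongrLeft 2 ℂ ℂ (xorPerm g)

/-- The effect of one quantum call to `F`: the unitary `|x, b, c⟩ ↦ |x, b, c ⊕ F x⟩`. -/
def callGate {X : Type u} [Fintype X] (F : X → Bool) : Gate X :=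
  xorGate fun x _ => F x

/-- The Hadamard transform of the target qubit, as a linear map. -/
def hadamardLin (X : Type u) [Fintype X] : State X →ₗ[ℂ] State X where
  toFun ψ := WithLp.toLp 2 fun i =>
    (ψ (i.1, i.2.1, false) + (if i.2.2 then -1 else 1) * ψ (i.1, i.2.1, true)) / (√2 : ℝ)
  map_add' ψ φ := by
    ext i
    simp only [PiLp.add_apply]
    ring
  map_smul' a ψ := by
    ext i
    simp only [PiLp.smul_apply, smul_eq_mul, RingHom.id_apply]
    ring

theorem hadamardLin_involutive (X : Type u) [Fintype X] :
    Function.Involutive (hadamardLin X) := by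
  have h2 : ((√2 : ℝ) : ℂ) * ((√2 : ℝ) : ℂ) = 2 := by
    rw [← Complex.ofReal_mul, Real.mul_self_sqrt (by norm_num)]
    norm_num
  have h0 : ((√2 : ℝ) : ℂ) ≠ 0 := by
    intro h
    rw [h] at h2
    norm_num at h2
  intro ψ
  ext ⟨x, b, c⟩
  have h2' : ((√2 : ℝ) : ℂ) ^ 2 = 2 := by rw [sq, h2]
  cases c <;> simp [hadamardLin] <;> field_simp <;> rw [h2'] <;> ring

theorem norm_hadamardLin {X : Type u} [Fintype X] (ψ : State X) :
    ‖hadamardLin X ψ‖ = ‖ψ‖ := by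
  rw [EuclideanSpace.norm_eq, EuclideanSpace.norm_eq]
  congr 1
  rw [Fintype.sum_prod_type, Fintype.sum_prod_type]
  refine Finset.sum_congr rfl fun x _ => ?_
  rw [Fintype.sum_prod_type, Fintype.sum_prod_type]
  refine Finset.sum_congr rfl fun b _ => ?_
  have h := parallelogram_law_with_norm ℝ (ψ (x, b, false)) (ψ (x, b, true))
  have h2 : |√2| ^ 2 = (2 : ℝ) := by rw [sq_abs, Real.sq_sqrt (by norm_num)]
  simp only [Fintype.sum_bool, hadamardLin, LinearMap.coe_mk, AddHom.coe_mk, norm_div,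
    Complex.norm_real, Real.norm_eq_abs, div_pow, h2, if_true, neg_one_mul,
    ← sub_eq_add_neg, one_mul, Bool.false_eq_true, if_false]
  nlinarith [h]

/-- The Hadamard gate on the target qubit. -/
def hadamardGate (X : Type u) [Fintype X] : Gate X where
  toLinearEquiv := LinearEquiv.ofInvolutive (hadamardLin X) (hadamardLin_involutive X)
  norm_map' := norm_hadamardLin

/-- One step of a circuit: a unitary that does not depend on `F`, or a call to `F`. -/
inductive Step (X : Type u) [Fintype X] : Type u
  | gate (U : Gate X)
  | call

/-- The unitary that a step performs when the function is `F`. -/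
def Step.toGate {X : Type u} [Fintype X] (F : X → Bool) : Step X → Gate X
  | .gate U => U
  | .call => callGate F

/-- The number of calls to `F` in a step. -/
def Step.calls {X : Type u} [Fintype X] : Step X → ℕ
  | .gate _ => 0
  | .call => 1

/-- A circuit: an initial state and a list of steps, performed from left to right.  None of it
depends on `F`. -/
structure Circuit (X : Type u) [Fintype X] : Type u where
  init : State X
  norm_init : ‖init‖ = 1
  steps : List (Step X)

/-- The final state of the circuit when the function is `F`. -/
def Circuit.final {X : Type u} [Fintype X] (F : X → Bool) (c : Circuit X) : State X :=
  c.steps.foldl (fun ψ s => s.toGate F ψ) c.init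

/-- The number of calls to `F` that the circuit makes. -/
def Circuit.calls {X : Type u} [Fintype X] (c : Circuit X) : ℕ :=
  (c.steps.map Step.calls).sum

theorem norm_foldl {X : Type u} [Fintype X] (F : X → Bool) (l : List (Step X)) (ψ : State X) :
    ‖l.foldl (fun ψ s => s.toGate F ψ) ψ‖ = ‖ψ‖ := by
  induction l generalizing ψ with
  | nil => rfl
  | cons s l ih => rw [List.foldl_cons, ih, LinearIsometryEquiv.norm_map]

theorem born_sum {X : Type u} [Fintype X] (ψ : State X) (h : ‖ψ‖ = 1) :
    ∑ i, ENNReal.ofReal (‖ψ i‖ ^ 2) = 1 := by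
  rw [← ENNReal.ofReal_sum_of_nonneg fun _ _ => sq_nonneg _, ← EuclideanSpace.norm_sq_eq, h]
  simp

/-- The distribution of the first register when the final state is measured (Born rule). -/
def Circuit.measure {X : Type u} [Fintype X] (F : X → Bool) (c : Circuit X) : PMF X :=
  (PMF.ofFintype (fun i => ENNReal.ofReal (‖c.final F i‖ ^ 2))
    (born_sum _ ((norm_foldl F c.steps c.init).trans c.norm_init))).map Prod.fst

/-! ### Algorithms that call `F`, and their semantics -/

/-- A (hybrid) algorithm that calls a function on `X` and outputs an element of `α`. -/
inductive Alg (X : Type u) [Fintype X] (α : Type v) : Type (max u v)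
  /-- Stop and output `a`. -/
  | ret (a : α)
  /-- Choose an integer `0 ≤ j ≤ n` uniformly at random and go on with `k j`. -/
  | choose (n : ℕ) (k : ℕ → Alg X α)
  /-- Call the function classically at `x` and go on with the value. -/
  | eval (x : X) (k : Bool → Alg X α)
  /-- Run the circuit `c`, measure its first register and go on with the outcome. -/
  | quantum (c : Circuit X) (k : X → Alg X α)

/-- Sequential composition. -/
def Alg.bind {X : Type u} [Fintype X] {α : Type v} {β : Type w} (A : Alg X α)
    (f : α → Alg X β) : Alg X β :=
  match A with
  | .ret a => f a
  | .choose n k => .choose n fun j => (k j).bind f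
  | .eval x k => .eval x fun y => (k y).bind f
  | .quantum c k => .quantum c fun x => (k x).bind f

/-- The joint distribution of the output and of the total number of calls to the function, when
the function is `F`. -/
def Alg.run {X : Type u} [Fintype X] {α : Type v} (F : X → Bool) : Alg X α → PMF (α × ℕ)
  | .ret a => PMF.pure (a, 0)
  | .choose n k =>
      (PMF.uniformOfFinset (Finset.range (n + 1)) Finset.nonempty_range_add_one).bind
        fun j => (k j).run F
  | .eval x k => ((k (F x)).run F).map fun p => (p.1, p.2 + 1)
  | .quantum c k =>
      (c.measure F).bind fun x => ((k x).run F).map fun p => (p.1, p.2 + c.calls)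

/-- The expected number of calls to `F`. -/
def Alg.expectedCalls {X : Type u} [Fintype X] {α : Type v} (A : Alg X α) (F : X → Bool) :
    ENNReal :=
  ∑' p : α × ℕ, A.run F p * (p.2 : ENNReal)

/-- The probability that the output is not `a`. -/
def Alg.probNe {X : Type u} [Fintype X] {α : Type v} (A : Alg X α) (F : X → Bool) (a : α) :
    ENNReal :=
  (A.run F).toOuterMeasure {p | p.1 ≠ a}

/-! ### Grover's algorithm

A finite set `H` of elements is excluded: the searched function is `F' x = 1` if `F x = 1` and
`x ∉ H`, and `F' x = 0` otherwise.  Each call to `F'` makes one call to `F`. -/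

/-- The uniform superposition of the elements of `X`, with ancilla `cos α |0⟩ + sin α |1⟩` and
target `|0⟩`. -/
def groverInit (X : Type u) [Fintype X] (α : ℝ) : State X :=
  WithLp.toLp 2 fun i =>
    if i.2.2 then 0
    else (((if i.2.1 then Real.sin α else Real.cos α) / √(Fintype.card X : ℝ) : ℝ) : ℂ)

theorem norm_groverInit (X : Type u) [Fintype X] [Nonempty X] (α : ℝ) :
    ‖groverInit X α‖ = 1 := by
  have hN : (Fintype.card X : ℝ) ≠ 0 := by exact_mod_cast Fintype.card_ne_zero
  rw [EuclideanSpace.norm_eq, Real.sqrt_eq_one, Fintype.sum_prod_type]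
  simp only [groverInit, Fintype.sum_prod_type, Fintype.sum_bool, if_true, norm_zero,
    Bool.false_eq_true, if_false, Complex.norm_real, Real.norm_eq_abs, sq_abs, div_pow,
    Real.sq_sqrt (Nat.cast_nonneg _), Finset.sum_const, Finset.card_univ, nsmul_eq_mul]
  field_simp
  rw [zero_pow two_ne_zero]
  linarith [Real.sin_sq_add_cos_sq α]

/-- The unitary `|x, b, c⟩ ↦ |x, b, c ⊕ 1⟩` if `b = 1` and `x ∉ H`, and the identity otherwise. -/
def exclGate {X : Type u} [Fintype X] [DecidableEq X] (H : Finset X) : Gate X :=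
  xorGate fun x b => b && decide (x ∉ H)

/-- One Grover iteration.  On states whose target qubit is `|0⟩`, the first five steps flip the
sign of the basis states with `b = 1` and `F' x = 1`; the last step is `2|ψ⟩⟨ψ| - 1`, where `ψ`
is the initial state. -/
def groverIteration {X : Type u} [Fintype X] [DecidableEq X] (H : Finset X) (α : ℝ) :
    List (Step X) :=
  [.gate (exclGate H), .gate (hadamardGate X), .call, .gate (hadamardGate X),
    .gate (exclGate H), .gate (Submodule.span ℂ {groverInit X α}).reflection]

/-- The circuit with `j` Grover iterations.  For `α = π / 2` the ancilla is constantly `|1⟩`,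
and this is Grover's original algorithm. -/
def groverCircuit {X : Type u} [Fintype X] [DecidableEq X] [Nonempty X] (H : Finset X) (α : ℝ)
    (j : ℕ) : Circuit X where
  init := groverInit X α
  norm_init := norm_groverInit X α
  steps := (List.replicate j (groverIteration H α)).flatten

/-- Run the circuit with `j` Grover iterations, let `i` be the outcome, and call `F` at `i`: if
`F' i = 1`, output `i`, otherwise output `none` (the special value *false*). -/
def groverTry {X : Type u} [Fintype X] [DecidableEq X] [Nonempty X] (H : Finset X) (α : ℝ)
    (j : ℕ) : Alg X (Option X) :=
  .quantum (groverCircuit H α j) fun i =>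
    .eval i fun y => .ret (if y = true ∧ i ∉ H then some i else none)

/-- Run `A`; if its output is `none`, run `B` instead. -/
def orElse {X : Type u} [Fintype X] (A B : Alg X (Option X)) : Alg X (Option X) :=
  A.bind fun o => match o with
    | some x => .ret (some x)
    | none => B

/-- Run `A` up to `n` times, until its output is not `none`. -/
def attempts {X : Type u} [Fintype X] (A : Alg X (Option X)) : ℕ → Alg X (Option X)
  | 0 => .ret none
  | n + 1 => orElse A (attempts A n)

/-! ### The search algorithm *BBHT* -/

/-- Choose an integer `0 ≤ j < m` uniformly at random, for a real number `m ≥ 1`, and execute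
Grover's original algorithm with `j` iterations. -/
def randomGrover {X : Type u} [Fintype X] [DecidableEq X] [Nonempty X] (H : Finset X) (m : ℝ) :
    Alg X (Option X) :=
  .choose (⌈m⌉₊ - 1) fun j => groverTry H (Real.pi / 2) j

/-- The main loop: `n` rounds, where `m` is multiplied by `8 / 7` after each of them. -/
def bbhtLoop {X : Type u} [Fintype X] [DecidableEq X] [Nonempty X] (H : Finset X) :
    ℕ → ℝ → Alg X (Option X)
  | 0, _ => .ret none
  | n + 1, m => orElse (randomGrover H m) (bbhtLoop H n (8 / 7 * m))

/-- The search algorithm *BBHT*: `m` is initially `1`, and the loop goes on while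
`m ≤ 2 √N`, that is, in the rounds `k = 0, 1, 2, …` with `(8 / 7) ^ k ≤ 2 √N`. -/
def bbht {X : Type u} [Fintype X] [DecidableEq X] [Nonempty X] (H : Finset X) :
    Alg X (Option X) :=
  bbhtLoop H (⌊Real.logb (8 / 7) (2 * √(Fintype.card X : ℝ))⌋₊ + 1) 1

/-! ### The search algorithm *BCWZ* -/

/-- The angle `θ` in `[0, π / 2]` with `sin² θ = t / N`. -/
def angle (N t : ℕ) : ℝ := Real.arcsin √((t : ℝ) / N)

/-- The number `⌈π / (4 θ) - 1 / 2⌉` of iterations for the exact search. -/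
def exactIterations (N t : ℕ) : ℕ := ⌈Real.pi / (4 * angle N t) - 1 / 2⌉₊

/-- Exact search, under the assumption that there are exactly `t` solutions: the ancilla reduces
the initial success amplitude from `sin θ` to `sin (π / (4 n + 2))`, so that `n` Grover
iterations succeed with certainty. -/
def exactSearch {X : Type u} [Fintype X] [DecidableEq X] [Nonempty X] (H : Finset X) (t : ℕ) :
    Alg X (Option X) :=
  groverTry H
    (Real.arcsin (Real.sin (Real.pi / (4 * exactIterations (Fintype.card X) t + 2)) /
      Real.sin (angle (Fintype.card X) t)))
    (exactIterations (Fintype.card X) t)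

/-- Exact searches for `s, s + 1, …, s + n - 1` solutions, until one of them succeeds. -/
def exactSearches {X : Type u} [Fintype X] [DecidableEq X] [Nonempty X] (H : Finset X) :
    ℕ → ℕ → Alg X (Option X)
  | 0, _ => .ret none
  | n + 1, s => orElse (exactSearch H s) (exactSearches H n (s + 1))

/-- The parameter `t₀ = ⌈lg ε⁻¹⌉`, capped at `N` (the largest possible number of solutions). -/
def bcwzParam (N : ℕ) (ε : ℝ) : ℕ := min ⌈Real.logb 2 ε⁻¹⌉₊ N

/-- The search algorithm *BCWZ* with parameter `ε⁻¹`: exact searches for `t = 1, …, t₀`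
solutions, and then `t₀` searches with `O(√(N / t₀))` calls each.  Each of the latter makes three
attempts, and has error at most `1 / 2` if there are more than `t₀` solutions. -/
def bcwz {X : Type u} [Fintype X] [DecidableEq X] [Nonempty X] (ε : ℝ) (H : Finset X) :
    Alg X (Option X) :=
  orElse (exactSearches H (bcwzParam (Fintype.card X) ε) 1)
    (attempts
      (attempts (randomGrover H √((Fintype.card X : ℝ) / bcwzParam (Fintype.card X) ε)) 3)
      (bcwzParam (Fintype.card X) ε))

/-! ### The algorithms *findsol* and *findall* -/

/-- The algorithm *findsol* with parameter `ε⁻¹`, for a solution of `F` that is not in `H`: run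
*BBHT* up to two times, and if that finds nothing, run *BCWZ* with parameter `ε⁻¹`. -/
def findsol {X : Type u} [Fintype X] [DecidableEq X] [Nonempty X] (ε : ℝ) (H : Finset X) :
    Alg X (Option X) :=
  orElse (attempts (bbht H) 2) (bcwz ε H)

/-- The loop of *findall*, for at most `n` rounds: `H` is the set of the solutions found so far. -/
def findallLoop {X : Type u} [Fintype X] [DecidableEq X] [Nonempty X] (ε : ℝ) :
    ℕ → Finset X → Alg X (Finset X)
  | 0, H => .ret H
  | n + 1, H => (findsol ε H).bind fun o => match o with
    | some x => findallLoop ε n (insert x H)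
    | none => .ret H

/-- The algorithm *findall* with parameter `ε⁻¹`.  As *findsol* only returns elements that are
not in `H`, the loop ends by itself within `N + 1` rounds. -/
def findall (X : Type u) [Fintype X] [DecidableEq X] [Nonempty X] (ε : ℝ) : Alg X (Finset X) :=
  findallLoop ε (Fintype.card X + 1) ∅

/-- The set of the solutions of `F`. -/
def solutions {X : Type u} [Fintype X] (F : X → Bool) : Finset X :=
  Finset.univ.filter fun x => F x = true

end QuantumSearch

end

noncomputable section

namespace QuantumSearch

open scoped ENNReal

section

/-! ### Expectations -/

/-! Grover's iteration preserves the real plane of states that rescale the initial state separately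
on marked and unmarked basis states. If the marked part has weight sin² φ, then j iterations turn
the amplitudes into sin((2j+1)φ) and cos((2j+1)φ) (`final_groverCircuit`). Averaged over j < m with
m ≥ 1/sin φ, the failure probability is at most 3/4 (`sum_cos_sq_le`).

Let s solutions remain. The BBHT rounds before m reaches √(N/s) have geometrically growing cost.
From there on the expected cost decays geometrically, since 8/7 · 3/4 < 1, so the total is
O(√(N/s)). As 3/4 ≤ (7/8)², the failure probability beyond that point is of order (√(N/s)/m)², which
is at most 1/(2s) once m exceeds 2√N (`isSearch_bbht`). BCWZ always costs O(√(N t₀)). Its exact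
searches settle s ≤ t₀, and otherwise its t₀ repetitions leave an error of at most 2^(-t₀) ≤ ε
(`isSearch_bcwz`).

Two runs of BBHT make the probability of reaching BCWZ at most 1/(4s²). This is summable over s,
whereas a single run would leave a harmonic sum and a factor log M. Over all rounds of findall, BBHT
therefore costs ∑ √(N/s) = O(√(NM)), BCWZ contributes O(√(N t₀)) including the last round with s =
0, and the errors add up to ∑ ε/(4s²) ≤ ε (`expect_findallLoop_le`).

Cost and error are treated together, as the expectation of r · (number of calls) + g(output): r = 0
gives the error and r = 1, g = 0 gives the cost. -/

theorem tsum_bind_mul {α : Type v} {β : Type w} (p : PMF α) (f : α → PMF β) (g : β → ℝ≥0∞) :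
    ∑' b, (p.bind f) b * g b = ∑' a, p a * ∑' b, f a b * g b := by
  simp only [PMF.bind_apply, ← ENNReal.tsum_mul_right, ← ENNReal.tsum_mul_left]
  rw [ENNReal.tsum_comm]
  simp only [mul_assoc]

theorem tsum_pure_mul {α : Type v} (a : α) (g : α → ℝ≥0∞) :
    ∑' b, (PMF.pure a) b * g b = g a := by
  rw [tsum_eq_single a]
  · simp
  · intro b hb
    simp [hb]

theorem tsum_map_mul {α : Type v} {β : Type w} (p : PMF α) (f : α → β) (g : β → ℝ≥0∞) :
    ∑' b, (p.map f) b * g b = ∑' a, p a * g (f a) := by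
  simp only [PMF.map, tsum_bind_mul, Function.comp_apply, tsum_pure_mul]

/-- The expectation of `w * n + g a`, where `a` is the output of the algorithm and `n` is the
number of its calls. -/
def Alg.expect {X : Type u} [Fintype X] {α : Type v} (F : X → Bool) (w : ℝ≥0∞) (A : Alg X α)
    (g : α → ℝ≥0∞) : ℝ≥0∞ :=
  ∑' p : α × ℕ, A.run F p * (w * (p.2 : ℝ≥0∞) + g p.1)

variable {X : Type u} [Fintype X] {α : Type v} {β : Type w} (F : X → Bool) (r : ℝ≥0∞)

theorem tsum_run_shift (A : Alg X α) (g : α → ℝ≥0∞) (n : ℕ) :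
    ∑' p, ((A.run F).map fun p => (p.1, p.2 + n)) p * (r * (p.2 : ℝ≥0∞) + g p.1) =
      r * n + A.expect F r g := by
  rw [tsum_map_mul, Alg.expect]
  have h : ∀ p : α × ℕ, A.run F p * (r * ((p.2 + n : ℕ) : ℝ≥0∞) + g p.1) =
      A.run F p * (r * n) + A.run F p * (r * (p.2 : ℝ≥0∞) + g p.1) := by
    intro p
    push_cast
    ring
  simp only [h]
  rw [ENNReal.tsum_add, ENNReal.tsum_mul_right, PMF.tsum_coe, one_mul]

@[simp]
theorem expect_ret (a : α) (g : α → ℝ≥0∞) : (Alg.ret a : Alg X α).expect F r g = g a := by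
  rw [Alg.expect, Alg.run, tsum_pure_mul]
  simp

theorem expect_choose (n : ℕ) (k : ℕ → Alg X α) (g : α → ℝ≥0∞) :
    (Alg.choose n k).expect F r g =
      ∑' j, PMF.uniformOfFinset (Finset.range (n + 1)) Finset.nonempty_range_add_one j *
        (k j).expect F r g := by
  rw [Alg.expect, Alg.run, tsum_bind_mul]
  rfl

theorem expect_eval (x : X) (k : Bool → Alg X α) (g : α → ℝ≥0∞) :
    (Alg.eval x k).expect F r g = r + (k (F x)).expect F r g := by
  rw [Alg.expect, Alg.run, tsum_run_shift]
  simp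

theorem expect_quantum (c : Circuit X) (k : X → Alg X α) (g : α → ℝ≥0∞) :
    (Alg.quantum c k).expect F r g =
      ∑' x, c.measure F x * (r * c.calls + (k x).expect F r g) := by
  rw [Alg.expect, Alg.run, tsum_bind_mul]
  simp only [tsum_run_shift]

theorem expect_bind (A : Alg X α) (f : α → Alg X β) (g : β → ℝ≥0∞) :
    (A.bind f).expect F r g = A.expect F r fun a => (f a).expect F r g := by
  induction A with
  | ret a => simp [Alg.bind]
  | choose n k ih => simp only [Alg.bind, expect_choose, ih]
  | eval x k ih => simp only [Alg.bind, expect_eval, ih]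
  | quantum c k ih => simp only [Alg.bind, expect_quantum, ih]

theorem expectedCalls_eq_expect (A : Alg X α) :
    A.expectedCalls F = A.expect F 1 fun _ => 0 := by
  simp [Alg.expectedCalls, Alg.expect]

theorem probNe_eq_expect [DecidableEq α] (A : Alg X α) (a : α) :
    A.probNe F a = A.expect F 0 fun b => if b = a then 0 else 1 := by
  rw [Alg.probNe, PMF.toOuterMeasure_apply, Alg.expect]
  refine tsum_congr fun p => ?_
  by_cases h : p.1 = a <;> simp [Set.indicator, h]

/-! ### Algorithms that search for a solution -/

/-- `A` outputs `none` or a solution of `F` outside `H`; it makes at most `c` calls on average and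
outputs `none` with probability at most `q`. -/
structure IsSearch (F : X → Bool) (H : Finset X) (A : Alg X (Option X)) (c q : ℝ) : Prop where
  cost_nonneg : 0 ≤ c
  fail_nonneg : 0 ≤ q
  -- Here `g` plays the role of the expected charge of whatever runs next: `a` after success and an
  -- extra `b` after failure. It is unconstrained at all other outputs, so the bound also forces
  -- those to have probability zero.
  expect_le : ∀ (r a b : ℝ≥0∞) (g : Option X → ℝ≥0∞),
    (∀ x, F x = true → x ∉ H → g (some x) ≤ a) → g none ≤ a + b →
      A.expect F r g ≤ a + r * ENNReal.ofReal c + ENNReal.ofReal q * b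

namespace IsSearch

variable {F} {H : Finset X} {A B : Alg X (Option X)} {c q c' q' : ℝ}

theorem mono (h : IsSearch F H A c q) (hc : c ≤ c') (hq : q ≤ q') : IsSearch F H A c' q' where
  cost_nonneg := h.cost_nonneg.trans hc
  fail_nonneg := h.fail_nonneg.trans hq
  expect_le r a b g h₁ h₂ := by
    refine (h.expect_le r a b g h₁ h₂).trans ?_
    gcongr

theorem ret_none (F : X → Bool) (H : Finset X) : IsSearch F H (.ret none) 0 1 where
  cost_nonneg := le_rfl
  fail_nonneg := zero_le_one
  expect_le r a b g _ h₂ := by simpa using h₂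

/-- The extra charge for a failure of `A` is the cost of `B` plus the charge `b` weighted by the
failure of `B`. So `hA` is applied with r c' + q' b in place of `b`, and no conditional
probabilities are needed. -/
theorem orElse (hA : IsSearch F H A c q) (hB : IsSearch F H B c' q') :
    IsSearch F H (orElse A B) (c + q * c') (q * q') where
  cost_nonneg := add_nonneg hA.cost_nonneg (mul_nonneg hA.fail_nonneg hB.cost_nonneg)
  fail_nonneg := mul_nonneg hA.fail_nonneg hB.fail_nonneg
  expect_le r a b g h₁ h₂ := by
    rw [QuantumSearch.orElse, expect_bind]
    refine (hA.expect_le r a (r * ENNReal.ofReal c' + ENNReal.ofReal q' * b) _ ?_ ?_).trans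
      (le_of_eq ?_)
    · intro x hx hxH
      simpa using h₁ x hx hxH
    · rw [← add_assoc]
      exact hB.expect_le r a b g h₁ h₂
    · rw [ENNReal.ofReal_add hA.cost_nonneg (mul_nonneg hA.fail_nonneg hB.cost_nonneg),
        ENNReal.ofReal_mul hA.fail_nonneg, ENNReal.ofReal_mul hA.fail_nonneg]
      ring

theorem attempts (hA : IsSearch F H A c q) (hq : q ≤ 1) (n : ℕ) :
    IsSearch F H (attempts A n) (n * c) (q ^ n) := by
  induction n with
  | zero => simpa [QuantumSearch.attempts] using ret_none F H
  | succ n ih =>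
    refine (hA.orElse ih).mono ?_ (pow_succ' q n).ge
    have := mul_le_mul_of_nonneg_right hq ih.cost_nonneg
    push_cast
    linarith

theorem choose {n : ℕ} {k : ℕ → Alg X (Option X)} {c q : ℕ → ℝ}
    (h : ∀ j ≤ n, IsSearch F H (k j) (c j) (q j)) :
    IsSearch F H (.choose n k) ((∑ j ∈ Finset.range (n + 1), c j) / (n + 1))
      ((∑ j ∈ Finset.range (n + 1), q j) / (n + 1)) where
  cost_nonneg := by
    refine div_nonneg (Finset.sum_nonneg fun j hj => ?_) (by positivity)
    exact (h j (Finset.mem_range_succ_iff.1 hj)).cost_nonneg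
  fail_nonneg := by
    refine div_nonneg (Finset.sum_nonneg fun j hj => ?_) (by positivity)
    exact (h j (Finset.mem_range_succ_iff.1 hj)).fail_nonneg
  expect_le r a b g h₁ h₂ := by
    have hn : ((n : ℝ≥0∞) + 1) ≠ 0 := by simp
    have hn' : ((n : ℝ≥0∞) + 1) ≠ ⊤ := by simp
    have hc : ∀ j ∈ Finset.range (n + 1), 0 ≤ c j := fun j hj =>
      (h j (Finset.mem_range_succ_iff.1 hj)).cost_nonneg
    have hq : ∀ j ∈ Finset.range (n + 1), 0 ≤ q j := fun j hj =>
      (h j (Finset.mem_range_succ_iff.1 hj)).fail_nonneg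
    have hcast : ENNReal.ofReal ((n : ℝ) + 1) = (n : ℝ≥0∞) + 1 := by
      rw [ENNReal.ofReal_add (by positivity) (by positivity)]
      simp
    rw [expect_choose, tsum_eq_sum (s := Finset.range (n + 1))]
    · calc ∑ j ∈ Finset.range (n + 1),
            PMF.uniformOfFinset (Finset.range (n + 1)) Finset.nonempty_range_add_one j *
              (k j).expect F r g
          ≤ ∑ j ∈ Finset.range (n + 1), ((n : ℝ≥0∞) + 1)⁻¹ *
              (a + r * ENNReal.ofReal (c j) + ENNReal.ofReal (q j) * b) := by
            refine Finset.sum_le_sum fun j hj => ?_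
            rw [PMF.uniformOfFinset_apply_of_mem _ hj, Finset.card_range]
            push_cast
            gcongr
            exact (h j (Finset.mem_range_succ_iff.1 hj)).expect_le r a b g h₁ h₂
        _ = _ := by
            rw [← Finset.mul_sum, Finset.sum_add_distrib, Finset.sum_add_distrib,
              ← Finset.mul_sum, ← Finset.sum_mul, Finset.sum_const, Finset.card_range,
              ENNReal.ofReal_div_of_pos (by positivity), ENNReal.ofReal_div_of_pos (by positivity),
              ENNReal.ofReal_sum_of_nonneg hc, ENNReal.ofReal_sum_of_nonneg hq, hcast,
              nsmul_eq_mul, mul_add, mul_add]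
            push_cast
            rw [← mul_assoc, ENNReal.inv_mul_cancel hn hn', one_mul]
            simp only [div_eq_mul_inv]
            ring
    · intro j hj
      rw [PMF.uniformOfFinset_apply_of_notMem _ hj, zero_mul]

end IsSearch

end

/-! ### The states of Grover's algorithm -/

section Grover

variable {X : Type u} [Fintype X]

theorem xorGate_apply (g : X → Bool → Bool) (ψ : State X) (x : X) (b c : Bool) :
    xorGate g ψ (x, b, c) = ψ (x, b, xor c (g x b)) := by
  rw [xorGate, LinearIsometryEquiv.piLpCongrLeft_apply]
  rfl

theorem hadamardGate_apply (ψ : State X) (x : X) (b c : Bool) :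
    hadamardGate X ψ (x, b, c) =
      (ψ (x, b, false) + (if c then -1 else 1) * ψ (x, b, true)) / (√2 : ℝ) :=
  rfl

variable [DecidableEq X] (F : X → Bool) (H : Finset X) (α : ℝ)

/-- The state with amplitudes `a` and `b`, relative to the initial state, on the basis states that
are marked and that are not marked. -/
def groverState (a b : ℝ) : State X :=
  WithLp.toLp 2 fun i =>
    ((if i.2.1 = true ∧ F i.1 = true ∧ i.1 ∉ H then a else b : ℝ) : ℂ) * groverInit X α i

theorem groverState_one_one : groverState F H α 1 1 = groverInit X α := by
  ext i
  simp [groverState]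

/-- Conjugating the bit flip by the Hadamard gate gives a sign flip controlled by the target qubit.
The first `exclGate` sets that qubit exactly where b = 1 and x ∉ H, and the second one clears it
again. -/
theorem phase_flip (a b : ℝ) :
    exclGate H (hadamardGate X (callGate F (hadamardGate X (exclGate H (groverState F H α a b)))))
      = groverState F H α (-a) b := by
  have h2 : ((√2 : ℝ) : ℂ) ^ 2 = 2 := by
    rw [← Complex.ofReal_pow, Real.sq_sqrt (by norm_num)]
    norm_num
  have h0 : ((√2 : ℝ) : ℂ) ≠ 0 := by
    intro h
    rw [h] at h2
    norm_num at h2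
  ext ⟨x, d, c⟩
  by_cases hx : x ∈ H <;> rcases hF : F x <;> rcases d <;> rcases c <;>
    simp [exclGate, callGate, xorGate_apply, hadamardGate_apply, hF, hx, groverState,
      groverInit] <;>
    field_simp <;> (try simp only [h2]) <;> ring

/-- The number of solutions of `F` outside `H`. -/
def remaining (F : X → Bool) (H : Finset X) : ℕ :=
  (solutions F \ H).card

/-- The hypothesis `hφ` fixes φ as the rotation angle. Any φ with the right sin² is admitted, so
that it can be the angle of t/N for α = π/2 and π/(4n+2) in the exact search. -/
theorem norm_sq_marked {φ : ℝ}
    (hφ : Real.sin φ ^ 2 = Real.sin α ^ 2 * ((remaining F H : ℝ) / Fintype.card X)) :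
    ∑ i : X × Bool × Bool, (if i.2.1 = true ∧ F i.1 = true ∧ i.1 ∉ H then
      ‖groverInit X α i‖ ^ 2 else 0) = Real.sin φ ^ 2 := by
  have h : ∀ x : X, (if F x = true ∧ x ∉ H then
      Real.sin α ^ 2 / (Fintype.card X : ℝ) else 0) =
      if x ∈ solutions F \ H then Real.sin α ^ 2 / (Fintype.card X : ℝ) else 0 := by
    intro x
    simp [solutions]
  simp [Fintype.sum_prod_type, groverInit, div_pow, h,
    Complex.norm_real, -Complex.ofReal_div, -Finset.mem_sdiff, -Complex.ofReal_sin,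
    Finset.sum_ite_mem, hφ, remaining]
  ring

variable [Nonempty X]

theorem norm_sq_unmarked {φ : ℝ}
    (hφ : Real.sin φ ^ 2 = Real.sin α ^ 2 * ((remaining F H : ℝ) / Fintype.card X)) :
    ∑ i : X × Bool × Bool, (if i.2.1 = true ∧ F i.1 = true ∧ i.1 ∉ H then 0 else
      ‖groverInit X α i‖ ^ 2) = Real.cos φ ^ 2 := by
  have h : ∑ i : X × Bool × Bool, ‖groverInit X α i‖ ^ 2 = 1 := by
    rw [← EuclideanSpace.norm_sq_eq, norm_groverInit, one_pow]
  rw [Real.cos_sq', ← norm_sq_marked F H α hφ, eq_sub_iff_add_eq, ← Finset.sum_add_distrib, ← h]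
  refine Finset.sum_congr rfl fun i _ => ?_
  split_ifs <;> simp

theorem inner_groverState {φ : ℝ}
    (hφ : Real.sin φ ^ 2 = Real.sin α ^ 2 * ((remaining F H : ℝ) / Fintype.card X)) (a b : ℝ) :
    inner ℂ (groverInit X α) (groverState F H α a b) =
      ((a * Real.sin φ ^ 2 + b * Real.cos φ ^ 2 : ℝ) : ℂ) := by
  rw [← norm_sq_marked F H α hφ, ← norm_sq_unmarked F H α hφ, Finset.mul_sum, Finset.mul_sum,
    ← Finset.sum_add_distrib, PiLp.inner_apply, Complex.ofReal_sum]
  refine Finset.sum_congr rfl fun i _ => ?_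
  have h : groverInit X α i * (starRingEnd ℂ) (groverInit X α i) =
      ((‖groverInit X α i‖ ^ 2 : ℝ) : ℂ) := by
    rw [Complex.mul_conj, Complex.normSq_eq_norm_sq]
  simp only [groverState, RCLike.inner_apply]
  rw [mul_assoc, h]
  split_ifs <;> push_cast <;> ring

theorem reflection_groverState {φ : ℝ}
    (hφ : Real.sin φ ^ 2 = Real.sin α ^ 2 * ((remaining F H : ℝ) / Fintype.card X)) (a b : ℝ) :
    (Submodule.span ℂ {groverInit X α}).reflection (groverState F H α a b) =
      groverState F H α (2 * (a * Real.sin φ ^ 2 + b * Real.cos φ ^ 2) - a)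
        (2 * (a * Real.sin φ ^ 2 + b * Real.cos φ ^ 2) - b) := by
  rw [Submodule.reflection_singleton_apply, inner_groverState F H α hφ, norm_groverInit]
  ext i
  simp only [groverState, PiLp.sub_apply, PiLp.smul_apply, smul_eq_mul, two_smul, PiLp.add_apply]
  split_ifs <;> push_cast <;> simp <;> ring

theorem foldl_groverIteration {φ : ℝ}
    (hφ : Real.sin φ ^ 2 = Real.sin α ^ 2 * ((remaining F H : ℝ) / Fintype.card X)) (a b : ℝ) :
    (groverIteration H α).foldl (fun ψ s => s.toGate F ψ) (groverState F H α a b) =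
      groverState F H α (2 * (-a * Real.sin φ ^ 2 + b * Real.cos φ ^ 2) + a)
        (2 * (-a * Real.sin φ ^ 2 + b * Real.cos φ ^ 2) - b) := by
  simp only [groverIteration, List.foldl_cons, List.foldl_nil, Step.toGate]
  rw [phase_flip, reflection_groverState F H α hφ, sub_neg_eq_add]

/-- Flip and reflection together rotate by 2φ. The relations are stated as products because `a` or
`b` is not determined when sin φ or cos φ vanishes, that is, when nothing or everything is marked.
-/
theorem final_groverCircuit {φ : ℝ}
    (hφ : Real.sin φ ^ 2 = Real.sin α ^ 2 * ((remaining F H : ℝ) / Fintype.card X)) (j : ℕ) :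
    ∃ a b : ℝ, (groverCircuit H α j).final F = groverState F H α a b ∧
      Real.sin φ * a = Real.sin ((2 * j + 1) * φ) ∧
      Real.cos φ * b = Real.cos ((2 * j + 1) * φ) := by
  simp only [groverCircuit, Circuit.final]
  induction j with
  | zero => exact ⟨1, 1, by simp [groverState_one_one], by simp, by simp⟩
  | succ j ih =>
    obtain ⟨a, b, h, ha, hb⟩ := ih
    refine ⟨2 * (-a * Real.sin φ ^ 2 + b * Real.cos φ ^ 2) + a,
      2 * (-a * Real.sin φ ^ 2 + b * Real.cos φ ^ 2) - b, ?_, ?_, ?_⟩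
    · rw [List.replicate_succ', List.flatten_append, List.foldl_append, h, List.flatten_singleton,
        foldl_groverIteration F H α hφ]
    · have : (2 * ((j + 1 : ℕ) : ℝ) + 1) * φ = (2 * j + 1) * φ + 2 * φ := by
        push_cast
        ring
      rw [this, Real.sin_add, ← ha, ← hb, Real.sin_two_mul, Real.cos_two_mul]
      linear_combination (-2 * a * Real.sin φ) * Real.sin_sq_add_cos_sq φ
    · have : (2 * ((j + 1 : ℕ) : ℝ) + 1) * φ = (2 * j + 1) * φ + 2 * φ := by
        push_cast
        ring
      rw [this, Real.cos_add, ← ha, ← hb, Real.sin_two_mul, Real.cos_two_mul]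
      ring

theorem calls_groverCircuit (j : ℕ) : (groverCircuit H α j).calls = j := by
  simp only [groverCircuit, Circuit.calls]
  induction j with
  | zero => simp
  | succ j ih =>
    rw [List.replicate_succ', List.flatten_append, List.map_append, List.sum_append, ih]
    simp [groverIteration, Step.calls]

/-- Only an inequality: a solution measured with ancilla 0 is unmarked but still passes the
classical check. -/
theorem sum_measure_groverCircuit_le {φ : ℝ}
    (hφ : Real.sin φ ^ 2 = Real.sin α ^ 2 * ((remaining F H : ℝ) / Fintype.card X)) (j : ℕ) :
    ∑' x, (groverCircuit H α j).measure F x * (if F x = true ∧ x ∉ H then 0 else 1) ≤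
      ENNReal.ofReal (Real.cos ((2 * j + 1) * φ) ^ 2) := by
  obtain ⟨a, b, h, -, hb⟩ := final_groverCircuit F H α hφ j
  rw [Circuit.measure, tsum_map_mul, tsum_fintype, ← hb, mul_pow, ← norm_sq_unmarked F H α hφ,
    Finset.sum_mul, ENNReal.ofReal_sum_of_nonneg]
  · refine Finset.sum_le_sum fun i _ => ?_
    rw [PMF.ofFintype_apply, h]
    by_cases hi : F i.1 = true ∧ i.1 ∉ H
    · simp [hi]
    · have hi' : ¬ (i.2.1 = true ∧ F i.1 = true ∧ i.1 ∉ H) := fun h => hi h.2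
      rw [if_neg hi, if_neg hi', mul_one]
      refine ENNReal.ofReal_le_ofReal (le_of_eq ?_)
      simp only [groverState, if_neg hi', norm_mul, Complex.norm_real, mul_pow, Real.norm_eq_abs,
        sq_abs]
      ring
  · intro i _
    split_ifs <;> positivity

theorem isSearch_groverTry {φ : ℝ}
    (hφ : Real.sin φ ^ 2 = Real.sin α ^ 2 * ((remaining F H : ℝ) / Fintype.card X)) (j : ℕ) :
    IsSearch F H (groverTry H α j) (j + 1) (Real.cos ((2 * j + 1) * φ) ^ 2) where
  cost_nonneg := by positivity
  fail_nonneg := by positivity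
  expect_le r a b g h₁ h₂ := by
    have hj : ENNReal.ofReal ((j : ℝ) + 1) = (j : ℝ≥0∞) + 1 := by
      rw [ENNReal.ofReal_add (by positivity) (by positivity)]
      simp
    rw [groverTry, expect_quantum, calls_groverCircuit, hj]
    calc _ ≤ ∑' x, ((groverCircuit H α j).measure F x * (a + r * (j + 1)) +
            (groverCircuit H α j).measure F x * (if F x = true ∧ x ∉ H then 0 else 1) * b) := by
          refine ENNReal.tsum_le_tsum fun x => ?_
          rw [mul_assoc, ← mul_add, expect_eval, expect_ret]
          refine mul_le_mul' le_rfl ?_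
          by_cases hx : F x = true ∧ x ∉ H
          · rw [if_pos hx, if_pos hx]
            calc _ ≤ r * j + (r + a) := by gcongr; exact h₁ x hx.1 hx.2
              _ = _ := by ring
          · rw [if_neg hx, if_neg hx]
            calc _ ≤ r * j + (r + (a + b)) := by gcongr
              _ = _ := by ring
      _ ≤ _ := by
          rw [ENNReal.tsum_add, ENNReal.tsum_mul_right, ENNReal.tsum_mul_right, PMF.tsum_coe,
            one_mul]
          gcongr
          exact sum_measure_groverCircuit_le F H α hφ j

/-- The cost of a search step does not depend on the number of solutions. -/
theorem isSearch_groverTry_one (j : ℕ) : IsSearch F H (groverTry H α j) (j + 1) 1 := by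
  have h0 : 0 ≤ Real.sin α ^ 2 * ((remaining F H : ℝ) / Fintype.card X) := by positivity
  have h1 : Real.sin α ^ 2 * ((remaining F H : ℝ) / Fintype.card X) ≤ 1 := by
    refine mul_le_one₀ (Real.sin_sq_le_one α) (by positivity) (div_le_one_of_le₀ ?_ (by positivity))
    exact_mod_cast Finset.card_le_univ _
  refine (isSearch_groverTry F H α
    (φ := Real.arcsin √(Real.sin α ^ 2 * ((remaining F H : ℝ) / Fintype.card X))) ?_ j).mono le_rfl
    (Real.cos_sq_le_one _)
  rw [Real.sin_arcsin (by linarith [Real.sqrt_nonneg (Real.sin α ^ 2 *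
    ((remaining F H : ℝ) / Fintype.card X))]) (Real.sqrt_le_one.2 h1), Real.sq_sqrt h0]

end Grover

/-! ### The average over the number of iterations -/

/-- Telescoping: 2 sin x cos((2j+1)x) = sin((2j+2)x) - sin(2jx). -/
theorem two_mul_sin_mul_sum_cos (x : ℝ) (m : ℕ) :
    2 * Real.sin x * ∑ j ∈ Finset.range m, Real.cos ((2 * j + 1) * x) = Real.sin (2 * m * x) := by
  induction m with
  | zero => simp
  | succ m ih =>
    have h₁ : 2 * ((m + 1 : ℕ) : ℝ) * x = (2 * m + 1) * x + x := by
      push_cast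
      ring
    have h₂ : 2 * (m : ℝ) * x = (2 * m + 1) * x - x := by ring
    rw [Finset.sum_range_succ, mul_add, ih, h₁, h₂, Real.sin_add, Real.sin_sub]
    ring

theorem sum_cos_nonneg {y : ℝ} (hy₀ : 0 ≤ y) (hy : y ≤ Real.pi / 2) {m : ℕ}
    (hm : m * Real.sin y < 1) : 0 ≤ ∑ j ∈ Finset.range m, Real.cos ((2 * j + 1) * y) := by
  rcases hy₀.eq_or_lt with rfl | hy₀
  · simp
  have hs : 0 < Real.sin y := Real.sin_pos_of_pos_of_lt_pi hy₀ (by linarith [Real.pi_pos])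
  -- Jordan's inequality turns m sin y < 1 into 2my ≤ π, so the closed form sin(2my)/(2 sin y) of
  -- the sum is nonnegative.
  have h : 2 / Real.pi * y ≤ Real.sin y := Real.mul_le_sin hy₀.le hy
  have h' : 2 * m * y ≤ Real.pi := by
    have : (m : ℝ) * (2 / Real.pi * y) ≤ 1 :=
      (mul_le_mul_of_nonneg_left h (Nat.cast_nonneg m)).trans hm.le
    have hpi := Real.pi_pos
    field_simp at this
    linarith
  have h₂ := Real.sin_nonneg_of_nonneg_of_le_pi (by positivity) h'
  rw [← two_mul_sin_mul_sum_cos] at h₂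
  exact nonneg_of_mul_nonneg_right h₂ (by positivity)

theorem sum_cos_le {x : ℝ} (hx₀ : 0 ≤ x) (hx : x ≤ Real.pi) {m : ℕ}
    (h : 1 ≤ m * Real.sin x ∨ Real.pi / 2 ≤ x) :
    ∑ j ∈ Finset.range m, Real.cos ((2 * j + 1) * x) ≤ m / 2 := by
  by_cases hm : 1 ≤ m * Real.sin x
  · have hs : 0 < Real.sin x := by
      have : 0 ≤ Real.sin x := Real.sin_nonneg_of_nonneg_of_le_pi hx₀ hx
      rcases this.eq_or_lt with h | h
      · rw [← h] at hm
        norm_num at hm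
      · exact h
    have := two_mul_sin_mul_sum_cos x m
    have h1 := Real.sin_le_one (2 * m * x)
    refine le_of_mul_le_mul_left ?_ (show 0 < 2 * Real.sin x by positivity)
    linarith
  -- The reflection x ↦ π - x changes the sign of every term, so here the sum is even nonpositive.
  · have hx' := h.resolve_left hm
    have key := sum_cos_nonneg (y := Real.pi - x) (m := m) (by linarith) (by linarith)
      (by rw [Real.sin_pi_sub]; exact not_le.1 hm)
    have : ∀ j : ℕ, Real.cos ((2 * j + 1) * (Real.pi - x)) = -Real.cos ((2 * j + 1) * x) := by
      intro j
      have : (2 * (j : ℝ) + 1) * (Real.pi - x) =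
          Real.pi - (2 * j + 1) * x + j * (2 * Real.pi) := by ring
      rw [this, Real.cos_add_nat_mul_two_pi, Real.cos_pi_sub]
    simp only [this, Finset.sum_neg_distrib] at key
    have : (0 : ℝ) ≤ m / 2 := by positivity
    linarith

/-- Write cos² as half of 1 + cos of the double angle. The bound has to hold up to θ = π/2, where
sin 2θ is small. If θ ≤ π/4, then cos θ ≥ 1/2 gives m sin 2θ ≥ 1; otherwise 2θ ≥ π/2 and
`sum_cos_le` needs nothing else. -/
theorem sum_cos_sq_le {θ : ℝ} (hθ₀ : 0 ≤ θ) (hθ : θ ≤ Real.pi / 2) {m : ℕ}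
    (h : 1 ≤ m * Real.sin θ) :
    ∑ j ∈ Finset.range m, Real.cos ((2 * j + 1) * θ) ^ 2 ≤ 3 / 4 * m := by
  have key : ∑ j ∈ Finset.range m, Real.cos ((2 * j + 1) * (2 * θ)) ≤ m / 2 := by
    refine sum_cos_le (by linarith) (by linarith) ?_
    by_cases h4 : θ ≤ Real.pi / 4
    · left
      have h0 := Real.sin_nonneg_of_nonneg_of_le_pi hθ₀ (by linarith)
      have hc : 1 / 2 ≤ Real.cos θ := by
        rw [← Real.cos_pi_div_three]
        exact Real.cos_le_cos_of_nonneg_of_le_pi hθ₀ (by linarith [Real.pi_pos])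
          (by linarith [Real.pi_pos])
      rw [Real.sin_two_mul]
      have := mul_le_mul_of_nonneg_left hc (show 0 ≤ 2 * (m * Real.sin θ) by positivity)
      linarith
    · right
      linarith
  have : ∀ j : ℕ, Real.cos ((2 * j + 1) * θ) ^ 2 =
      1 / 2 + Real.cos ((2 * j + 1) * (2 * θ)) / 2 := by
    intro j
    rw [Real.cos_sq]
    ring_nf
  simp only [this, Finset.sum_add_distrib, ← Finset.sum_div, Finset.sum_const, Finset.card_range,
    nsmul_eq_mul]
  linarith

/-! ### The Grover angle, and search steps with a random number of iterations. -/

theorem one_le_sqrt_card (X : Type u) [Fintype X] [Nonempty X] : 1 ≤ √(Fintype.card X : ℝ) := by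
  rw [Real.one_le_sqrt]
  exact_mod_cast Fintype.card_pos

theorem angle_nonneg (N t : ℕ) : 0 ≤ angle N t :=
  Real.arcsin_nonneg.2 (Real.sqrt_nonneg _)

theorem angle_le (N t : ℕ) : angle N t ≤ Real.pi / 2 :=
  Real.arcsin_le_pi_div_two _

theorem sin_angle {N t : ℕ} (h : t ≤ N) : Real.sin (angle N t) = √((t : ℝ) / N) := by
  have : (t : ℝ) / N ≤ 1 := div_le_one_of_le₀ (by exact_mod_cast h) (by positivity)
  rw [angle, Real.sin_arcsin (by linarith [Real.sqrt_nonneg ((t : ℝ) / N)])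
    (Real.sqrt_le_one.2 this)]

theorem sin_angle_sq {N t : ℕ} (h : t ≤ N) : Real.sin (angle N t) ^ 2 = (t : ℝ) / N := by
  rw [sin_angle h, Real.sq_sqrt (by positivity)]

section

variable {X : Type u} [Fintype X] [DecidableEq X] (F : X → Bool) (H : Finset X)

theorem remaining_le : remaining F H ≤ Fintype.card X :=
  Finset.card_le_univ _

variable [Nonempty X]

theorem sum_add_one_div_le (n : ℕ) :
    (∑ j ∈ Finset.range (n + 1), ((j : ℝ) + 1)) / (n + 1) ≤ n + 1 := by
  rw [div_le_iff₀ (by positivity)]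
  calc ∑ j ∈ Finset.range (n + 1), ((j : ℝ) + 1)
      ≤ ∑ _j ∈ Finset.range (n + 1), ((n : ℝ) + 1) := by
        refine Finset.sum_le_sum fun j hj => ?_
        have : (j : ℝ) ≤ n := by exact_mod_cast Finset.mem_range_succ_iff.1 hj
        linarith
    _ = _ := by rw [Finset.sum_const, Finset.card_range, nsmul_eq_mul]; push_cast; rfl

theorem ceil_sub_one_add_one {m : ℝ} (hm : 1 ≤ m) : ⌈m⌉₊ - 1 + 1 = ⌈m⌉₊ :=
  Nat.sub_add_cancel (Nat.one_le_ceil_iff.2 (by linarith))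

theorem ceil_sub_one_le {m : ℝ} (hm : 1 ≤ m) : ((⌈m⌉₊ - 1 : ℕ) : ℝ) + 1 ≤ 2 * m := by
  have : ((⌈m⌉₊ - 1 : ℕ) : ℝ) + 1 = ⌈m⌉₊ := by exact_mod_cast ceil_sub_one_add_one hm
  rw [this]
  linarith [Nat.ceil_lt_add_one (show 0 ≤ m by linarith)]

theorem isSearch_randomGrover_one {m : ℝ} (hm : 1 ≤ m) :
    IsSearch F H (randomGrover H m) (2 * m) 1 := by
  refine (IsSearch.choose fun j _ => isSearch_groverTry_one F H _ j).mono
    ((sum_add_one_div_le _).trans (ceil_sub_one_le hm)) ?_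
  simp
  rw [div_self (by positivity)]

theorem isSearch_randomGrover {m : ℝ} (hm : 1 ≤ m)
    (h : √((Fintype.card X : ℝ) / remaining F H) ≤ m) (h0 : 0 < remaining F H) :
    IsSearch F H (randomGrover H m) (2 * m) (3 / 4) := by
  have hN : 0 < Fintype.card X := Fintype.card_pos
  refine (IsSearch.choose fun j _ => isSearch_groverTry F H _
    (φ := angle (Fintype.card X) (remaining F H)) ?_ j).mono
    ((sum_add_one_div_le _).trans (ceil_sub_one_le hm)) ?_
  · rw [sin_angle_sq (remaining_le F H)]
    simp
  · rw [div_le_iff₀ (by positivity)]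
    have : ((⌈m⌉₊ - 1 : ℕ) : ℝ) + 1 = ((⌈m⌉₊ - 1 + 1 : ℕ) : ℝ) := by push_cast; rfl
    rw [this]
    refine sum_cos_sq_le (angle_nonneg _ _) (angle_le _ _) ?_
    rw [ceil_sub_one_add_one hm, sin_angle (remaining_le F H)]
    calc (1 : ℝ) = √((Fintype.card X : ℝ) / remaining F H) *
          √((remaining F H : ℝ) / Fintype.card X) := by
          rw [← Real.sqrt_mul (by positivity), eq_comm, Real.sqrt_eq_one]
          field_simp
      _ ≤ _ := by
          gcongr
          exact h.trans (Nat.le_ceil m)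

/-! ### BBHT -/

/-- Geometric sum of the round costs 2m (8/7)^k, with no use made of early success. -/
theorem isSearch_bbhtLoop_one (n : ℕ) {m : ℝ} (hm : 1 ≤ m) :
    IsSearch F H (bbhtLoop H n m) (14 * m * ((8 / 7) ^ n - 1)) 1 := by
  induction n generalizing m with
  | zero => simpa [bbhtLoop] using IsSearch.ret_none F H
  | succ n ih =>
    refine ((isSearch_randomGrover_one F H hm).orElse
      (ih (m := 8 / 7 * m) (by linarith))).mono (le_of_eq ?_) (by norm_num)
    ring

/-- The cost 14m solves 2m + 3/4 · 14 · (8/7)m = 14m. -/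
theorem isSearch_bbhtLoop_of_le (h0 : 0 < remaining F H) (n : ℕ) {m : ℝ} (hm : 1 ≤ m)
    (h : √((Fintype.card X : ℝ) / remaining F H) ≤ m) :
    IsSearch F H (bbhtLoop H n m) (14 * m) ((3 / 4) ^ n) := by
  induction n generalizing m with
  | zero => exact (IsSearch.ret_none F H).mono (by linarith) (by simp)
  | succ n ih =>
    refine ((isSearch_randomGrover F H hm h h0).orElse
      (ih (m := 8 / 7 * m) (by linarith) (by linarith))).mono (by linarith) (le_of_eq ?_)
    ring

/-- The term -14m is a potential: a round before the critical value s costs 2m, and 2m - 14 · (8/7)m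
= -14m. The first m ≥ s is at most (8/7)s, where 14m ≤ 32s - 14m. The failure bound is the squared
ratio of (8/7)s to the final m. -/
theorem isSearch_bbhtLoop (h0 : 0 < remaining F H) (n : ℕ) {m s : ℝ} (hm : 1 ≤ m)
    (hs : √((Fintype.card X : ℝ) / remaining F H) = s) (hms : m ≤ 8 / 7 * s) :
    IsSearch F H (bbhtLoop H n m) (32 * s - 14 * m) ((8 / 7 * s / (m * (8 / 7) ^ n)) ^ 2) := by
  have of_le : ∀ (n : ℕ) {m : ℝ}, 1 ≤ m → m ≤ 8 / 7 * s → s ≤ m →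
      IsSearch F H (bbhtLoop H n m) (32 * s - 14 * m)
        ((8 / 7 * s / (m * (8 / 7) ^ n)) ^ 2) := by
    intro n m hm hms hsm
    have hm0 : 0 < m := by linarith
    refine (isSearch_bbhtLoop_of_le F H h0 n hm (hs.trans_le hsm)).mono (by linarith) ?_
    -- Since 3/4 ≤ 49/64 = (7/8)², each further round pays for the growth of m² by (8/7)².
    calc ((3 : ℝ) / 4) ^ n ≤ (49 / 64) ^ n :=
        pow_le_pow_left₀ (by norm_num) (by norm_num) n
      _ = (1 * (1 / (8 / 7) ^ n)) ^ 2 := by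
        rw [one_mul, ← one_div_pow, ← pow_mul, mul_comm n 2, pow_mul]
        norm_num
      _ ≤ (8 / 7 * s / m * (1 / (8 / 7) ^ n)) ^ 2 := by
        gcongr
        rwa [le_div_iff₀ hm0, one_mul]
      _ = _ := by
        field_simp
  induction n generalizing m with
  | zero =>
    have hm0 : 0 < m := by linarith
    refine (IsSearch.ret_none F H).mono (by linarith) ?_
    rw [pow_zero, mul_one]
    refine one_le_pow₀ ?_
    rwa [le_div_iff₀ hm0, one_mul]
  | succ n ih =>
    rcases le_or_gt s m with hsm | hsm
    · exact of_le _ hm hms hsm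
    · refine ((isSearch_randomGrover_one F H hm).orElse
        (ih (m := 8 / 7 * m) (by linarith) (by linarith))).mono (by linarith) (le_of_eq ?_)
      rw [one_mul, mul_comm (8 / 7) m, mul_assoc m, ← pow_succ']

theorem pow_floor_logb_le {x : ℝ} (hx : 1 ≤ x) :
    (8 / 7 : ℝ) ^ (⌊Real.logb (8 / 7) x⌋₊ + 1) ≤ 8 / 7 * x := by
  have hx0 : 0 < x := by linarith
  have h : (8 / 7 : ℝ) ^ ⌊Real.logb (8 / 7) x⌋₊ ≤ x := by
    rw [← Real.rpow_natCast, ← Real.le_logb_iff_rpow_le (by norm_num) hx0]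
    exact Nat.floor_le (Real.logb_nonneg (by norm_num) hx)
  rw [pow_succ]
  linarith

theorem le_pow_floor_logb {x : ℝ} (hx : 1 ≤ x) :
    x ≤ (8 / 7 : ℝ) ^ (⌊Real.logb (8 / 7) x⌋₊ + 1) := by
  have hx0 : 0 < x := by linarith
  rw [← Real.rpow_natCast, ← Real.logb_le_iff_le_rpow (by norm_num) hx0]
  push_cast
  exact (Nat.lt_floor_add_one _).le

theorem isSearch_bbht_one : IsSearch F H (bbht H) (32 * √(Fintype.card X : ℝ)) 1 := by
  have h1 := one_le_sqrt_card X
  refine (isSearch_bbhtLoop_one F H _ le_rfl).mono ?_ le_rfl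
  have := pow_floor_logb_le (x := 2 * √(Fintype.card X : ℝ)) (by linarith)
  linarith

theorem isSearch_bbht (h0 : 0 < remaining F H) :
    IsSearch F H (bbht H) (32 * √((Fintype.card X : ℝ) / remaining F H))
      (1 / (2 * remaining F H)) := by
  have ht : (0 : ℝ) < remaining F H := by exact_mod_cast h0
  have h1 := one_le_sqrt_card X
  have hN : (0 : ℝ) < Fintype.card X := by exact_mod_cast Fintype.card_pos
  have hs : 1 ≤ √((Fintype.card X : ℝ) / remaining F H) := by
    rw [Real.one_le_sqrt, le_div_iff₀ ht, one_mul]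
    exact_mod_cast remaining_le F H
  refine (isSearch_bbhtLoop F H h0 _ le_rfl rfl (by linarith)).mono (by linarith) ?_
  have h2 := le_pow_floor_logb (x := 2 * √(Fintype.card X : ℝ)) (by linarith)
  calc (8 / 7 * √((Fintype.card X : ℝ) / remaining F H) /
        (1 * (8 / 7) ^ (⌊Real.logb (8 / 7) (2 * √(Fintype.card X : ℝ))⌋₊ + 1))) ^ 2
      ≤ (8 / 7 * √((Fintype.card X : ℝ) / remaining F H) / (2 * √(Fintype.card X : ℝ))) ^ 2 := by
        rw [one_mul]
        gcongr
    -- With final m at least 2√N, the squared ratio is (8/7)²/4 · 1/t = 16/(49t), where t is the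
    -- number of remaining solutions.
    _ = 16 / 49 * (1 / (remaining F H : ℝ)) := by
        rw [div_pow, mul_pow, mul_pow, Real.sq_sqrt (by positivity), Real.sq_sqrt hN.le]
        field_simp
        norm_num
    _ ≤ 1 / 2 * (1 / (remaining F H : ℝ)) :=
        mul_le_mul_of_nonneg_right (by norm_num) (by positivity)
    _ = _ := by field_simp

end

/-! ### BCWZ -/

/-- Comparison of ∑ 1/√s with a telescoping sum, used both for the exact searches and for the rounds
of findall. -/
theorem one_div_sqrt_le (s : ℕ) : 1 / √((s : ℝ) + 1) ≤ 2 * (√((s : ℝ) + 1) - √(s : ℝ)) := by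
  have h1 : 0 < √((s : ℝ) + 1) := by positivity
  have h2 : √(s : ℝ) ≤ √((s : ℝ) + 1) := Real.sqrt_le_sqrt (by linarith)
  rw [div_le_iff₀ h1]
  nlinarith [Real.sq_sqrt (show (0 : ℝ) ≤ s by positivity),
    Real.sq_sqrt (show (0 : ℝ) ≤ (s : ℝ) + 1 by positivity),
    sq_nonneg (√((s : ℝ) + 1) - √(s : ℝ))]

theorem angle_pos {N t : ℕ} (ht : 0 < t) (h : t ≤ N) : 0 < angle N t := by
  have : 0 < N := ht.trans_le h
  rw [angle, Real.arcsin_pos]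
  positivity

theorem le_exactIterations (N t : ℕ) :
    Real.pi / (4 * angle N t) - 1 / 2 ≤ exactIterations N t :=
  Nat.le_ceil _

theorem exactIterations_le {N t : ℕ} (ht : 0 < t) (h : t ≤ N) :
    (exactIterations N t : ℝ) + 1 ≤ 3 * √((N : ℝ) / t) := by
  have hθ := angle_pos ht h
  have ht' : (0 : ℝ) < t := by exact_mod_cast ht
  have hN' : (0 : ℝ) < N := by exact_mod_cast ht.trans_le h
  have h0 : 0 ≤ Real.pi / (4 * angle N t) - 1 / 2 := by
    rw [sub_nonneg, le_div_iff₀ (by positivity)]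
    linarith [angle_le N t]
  have hs : 1 ≤ √((N : ℝ) / t) := by
    rw [Real.one_le_sqrt, le_div_iff₀ ht', one_mul]
    exact_mod_cast h
  -- From θ ≥ sin θ = √(t/N) and π ≤ 4. The rounding up and the final check add at most 3/2, which
  -- √(N/t) ≥ 1 absorbs.
  have h1 : Real.pi / (4 * angle N t) ≤ √((N : ℝ) / t) := by
    have hsin := Real.sin_le hθ.le
    rw [sin_angle h] at hsin
    rw [div_le_iff₀ (by positivity)]
    have : √((N : ℝ) / t) * √((t : ℝ) / N) = 1 := by
      rw [← Real.sqrt_mul (by positivity), Real.sqrt_eq_one]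
      field_simp
    have h2 := mul_le_mul_of_nonneg_left hsin (show 0 ≤ √((N : ℝ) / t) by positivity)
    linarith [Real.pi_le_four]
  have := Nat.ceil_lt_add_one h0
  rw [exactIterations]
  linarith

theorem bcwzParam_le (N : ℕ) (ε : ℝ) : bcwzParam N ε ≤ N :=
  min_le_right _ _

theorem bcwzParam_pos {N : ℕ} (hN : 0 < N) {ε : ℝ} (h0 : 0 < ε) (h1 : ε < 1) :
    0 < bcwzParam N ε :=
  lt_min (Nat.ceil_pos.2 (Real.logb_pos (by norm_num) ((one_lt_inv₀ h0).2 h1))) hN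

/-- The hypothesis says that the cap at N is not active. It holds whenever more than t₀ solutions
remain. -/
theorem pow_bcwzParam_le {N : ℕ} {ε : ℝ} (h0 : 0 < ε) (h : bcwzParam N ε < N) :
    (1 / 2 : ℝ) ^ bcwzParam N ε ≤ ε := by
  have hc : ⌈Real.logb 2 ε⁻¹⌉₊ = bcwzParam N ε := by
    rw [bcwzParam] at h ⊢
    omega
  rw [one_div, inv_pow, inv_le_comm₀ (by positivity) h0, ← hc, ← Real.rpow_natCast,
    ← Real.logb_le_iff_le_rpow (by norm_num) (by positivity)]
  exact Nat.le_ceil _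

theorem one_le_sqrt_div_bcwzParam {N : ℕ} (hN : 0 < N) {ε : ℝ} (h0 : 0 < ε) (h1 : ε < 1) :
    1 ≤ √((N : ℝ) / bcwzParam N ε) := by
  have := bcwzParam_pos hN h0 h1
  rw [Real.one_le_sqrt, le_div_iff₀ (by exact_mod_cast this), one_mul]
  exact_mod_cast bcwzParam_le _ _

theorem bcwzParam_mul_sqrt {N : ℕ} (hN : 0 < N) {ε : ℝ} (h0 : 0 < ε) (h1 : ε < 1) :
    (bcwzParam N ε : ℝ) *
        ((3 : ℕ) * (2 * √((N : ℝ) / bcwzParam N ε))) =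
      6 * √((N : ℝ) * bcwzParam N ε) := by
  have ht : (0 : ℝ) < bcwzParam N ε := by
    exact_mod_cast bcwzParam_pos hN h0 h1
  rw [Real.sqrt_div (by positivity), Real.sqrt_mul (by positivity)]
  have := Real.mul_self_sqrt ht.le
  field_simp
  push_cast
  rw [sq, this]
  ring

section

variable {X : Type u} [Fintype X] [DecidableEq X] (F : X → Bool) (H : Finset X) [Nonempty X]

theorem isSearch_exactSearch_one {t : ℕ} (ht : 0 < t) (h : t ≤ Fintype.card X) :
    IsSearch F H (exactSearch H t) (3 * √((Fintype.card X : ℝ) / t)) 1 :=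
  (isSearch_groverTry_one F H _ _).mono (exactIterations_le ht h) le_rfl

theorem isSearch_exactSearch_zero (h0 : 0 < remaining F H) :
    IsSearch F H (exactSearch H (remaining F H))
      (3 * √((Fintype.card X : ℝ) / remaining F H)) 0 := by
  have hle := remaining_le F H
  have hθ := angle_pos h0 hle
  have hn := le_exactIterations (Fintype.card X) (remaining F H)
  set n := exactIterations (Fintype.card X) (remaining F H) with hn_def
  have hs : 0 < Real.sin (angle (Fintype.card X) (remaining F H)) :=
    Real.sin_pos_of_pos_of_lt_pi hθ (by linarith [angle_le (Fintype.card X) (remaining F H),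
      Real.pi_pos])
  -- The choice of n makes π/(4n+2) at most θ, so the quotient of sines is at most 1 and the ancilla
  -- angle really has it as its sine. Then (2n+1)φ = π/2 and the cosine vanishes.
  have hφ : Real.pi / (4 * n + 2) ≤ angle (Fintype.card X) (remaining F H) := by
    rw [sub_le_iff_le_add, div_le_iff₀ (by positivity)] at hn
    rw [div_le_iff₀ (by positivity)]
    linarith
  have hφ0 : 0 < Real.pi / (4 * n + 2) := by positivity
  have hsφ : 0 ≤ Real.sin (Real.pi / (4 * n + 2)) :=
    Real.sin_nonneg_of_nonneg_of_le_pi hφ0.le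
      (hφ.trans (by linarith [angle_le (Fintype.card X) (remaining F H), Real.pi_pos]))
  have hle1 : Real.sin (Real.pi / (4 * n + 2)) ≤
      Real.sin (angle (Fintype.card X) (remaining F H)) :=
    Real.sin_le_sin_of_le_of_le_pi_div_two (by linarith [Real.pi_pos]) (angle_le _ _) hφ
  refine (isSearch_groverTry F H _ (φ := Real.pi / (4 * n + 2)) ?_ _).mono
    (exactIterations_le h0 hle) (le_of_eq ?_)
  · rw [← hn_def, Real.sin_arcsin (by linarith [div_nonneg hsφ hs.le])
      (div_le_one_of_le₀ hle1 hs.le), ← sin_angle_sq hle, ← mul_pow, div_mul_cancel₀ _ hs.ne']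
  · have : (2 * (n : ℝ) + 1) * (Real.pi / (4 * n + 2)) = Real.pi / 2 := by
      field_simp
      ring
    rw [← hn_def, this, Real.cos_pi_div_two]
    norm_num

theorem isSearch_exactSearches (n s : ℕ) (h : s + n ≤ Fintype.card X) :
    IsSearch F H (exactSearches H n (s + 1))
      (6 * √(Fintype.card X : ℝ) * (√((s : ℝ) + n) - √(s : ℝ)))
      (if s < remaining F H ∧ remaining F H ≤ s + n then 0 else 1) := by
  induction n generalizing s with
  | zero =>
    refine (IsSearch.ret_none F H).mono (by simp) ?_
    rw [if_neg (by omega)]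
  | succ n ih =>
    have hB := ih (s + 1) (by omega)
    have hcost : 3 * √((Fintype.card X : ℝ) / ((s + 1 : ℕ) : ℝ)) ≤
        6 * √(Fintype.card X : ℝ) * (√((s : ℝ) + 1) - √(s : ℝ)) := by
      push_cast
      rw [Real.sqrt_div (by positivity), div_eq_mul_one_div]
      have := mul_le_mul_of_nonneg_left (one_div_sqrt_le s)
        (show 0 ≤ 3 * √(Fintype.card X : ℝ) by positivity)
      linarith
    have hsum : ((s + 1 : ℕ) : ℝ) + n = (s : ℝ) + ((n + 1 : ℕ) : ℝ) := by
      push_cast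
      ring
    -- If the current guess is right, the search cannot fail, and the later searches are weighted by
    -- 0.
    by_cases hs : remaining F H = s + 1
    · have hA := isSearch_exactSearch_zero F H (by omega)
      rw [hs] at hA
      refine (hA.orElse hB).mono ?_ ?_
      · have := hB.cost_nonneg
        rw [hsum] at this
        push_cast at this hcost ⊢
        linarith
      · rw [zero_mul]
        split_ifs <;> norm_num
    · refine ((isSearch_exactSearch_one F H (Nat.succ_pos s) (by omega)).orElse hB).mono ?_ ?_
      · rw [hsum]
        push_cast at hcost ⊢
        linarith
      · rw [one_mul]
        refine le_of_eq (if_congr ?_ rfl rfl)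
        omega

variable {ε : ℝ}

theorem isSearch_exactSearches_bcwz (ε : ℝ) :
    IsSearch F H (exactSearches H (bcwzParam (Fintype.card X) ε) 1)
      (6 * √((Fintype.card X : ℝ) * bcwzParam (Fintype.card X) ε))
      (if 0 < remaining F H ∧ remaining F H ≤ bcwzParam (Fintype.card X) ε then 0 else 1) := by
  have := isSearch_exactSearches F H (bcwzParam (Fintype.card X) ε) 0
    (by simpa using bcwzParam_le _ _)
  simpa [Real.sqrt_mul, mul_assoc] using this

theorem isSearch_bcwz_one (h0 : 0 < ε) (h1 : ε < 1) :
    IsSearch F H (bcwz ε H) (12 * √((Fintype.card X : ℝ) * bcwzParam (Fintype.card X) ε)) 1 := by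
  refine (((isSearch_exactSearches_bcwz F H ε).mono le_rfl ?_).orElse
    (((isSearch_randomGrover_one F H (one_le_sqrt_div_bcwzParam Fintype.card_pos h0 h1)).attempts
      le_rfl 3).attempts (by norm_num) _)).mono (q := 1 * _) ?_ (by norm_num)
  · split_ifs <;> norm_num
  · rw [bcwzParam_mul_sqrt Fintype.card_pos h0 h1]
    linarith

theorem isSearch_bcwz (h0 : 0 < ε) (h1 : ε < 1) (hr : 0 < remaining F H) :
    IsSearch F H (bcwz ε H) (12 * √((Fintype.card X : ℝ) * bcwzParam (Fintype.card X) ε)) ε := by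
  have hA := isSearch_exactSearches_bcwz F H ε
  by_cases hle : remaining F H ≤ bcwzParam (Fintype.card X) ε
  · rw [if_pos ⟨hr, hle⟩] at hA
    refine (hA.orElse (((isSearch_randomGrover_one F H
      (one_le_sqrt_div_bcwzParam Fintype.card_pos h0 h1)).attempts le_rfl 3).attempts
      (by norm_num) _)).mono ?_ (by simpa using h0.le)
    have := Real.sqrt_nonneg ((Fintype.card X : ℝ) * bcwzParam (Fintype.card X) ε)
    linarith
  · rw [if_neg (by tauto)] at hA
    have ht := bcwzParam_pos (Fintype.card_pos (α := X)) h0 h1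
    have hB := isSearch_randomGrover F H (one_le_sqrt_div_bcwzParam Fintype.card_pos h0 h1) (by
      gcongr
      omega) hr
    refine (hA.orElse ((hB.attempts (by norm_num) 3).attempts (by norm_num) _)).mono ?_ ?_
    · rw [bcwzParam_mul_sqrt Fintype.card_pos h0 h1]
      linarith
    -- Three attempts fail with probability at most (3/4)³ = 27/64 ≤ 1/2.
    · refine le_trans ?_ (pow_bcwzParam_le h0 ((not_le.1 hle).trans_le (remaining_le F H)))
      rw [one_mul]
      gcongr
      norm_num

/-! ### findsol and findall -/

theorem isSearch_findsol_one (h0 : 0 < ε) (h1 : ε < 1) :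
    IsSearch F H (findsol ε H) (64 * √(Fintype.card X : ℝ) +
      12 * √((Fintype.card X : ℝ) * bcwzParam (Fintype.card X) ε)) 1 := by
  refine (((isSearch_bbht_one F H).attempts le_rfl 2).orElse
    (isSearch_bcwz_one F H h0 h1)).mono (le_of_eq ?_) (by norm_num)
  push_cast
  ring

theorem isSearch_findsol (h0 : 0 < ε) (h1 : ε < 1) (hr : 0 < remaining F H) :
    IsSearch F H (findsol ε H) (64 * √((Fintype.card X : ℝ) / remaining F H) +
      (1 / (2 * remaining F H)) ^ 2 *
        (12 * √((Fintype.card X : ℝ) * bcwzParam (Fintype.card X) ε)))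
      ((1 / (2 * remaining F H)) ^ 2 * ε) := by
  have hr' : (1 : ℝ) ≤ remaining F H := by exact_mod_cast hr
  refine (((isSearch_bbht F H hr).attempts ?_ 2).orElse
    (isSearch_bcwz F H h0 h1 hr)).mono (le_of_eq ?_) le_rfl
  · rw [div_le_one (by positivity)]
    linarith
  · push_cast
    ring

/-- Every success lowers the number of remaining solutions by one, so each value s occurs at most
once. The cost sum includes s = 0, the last run that confirms that nothing is left. The error sum
omits it, since stopping there is correct. The hypothesis `hn` leaves a round for that run. -/
theorem expect_findallLoop_le {c q : ℕ → ℝ}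
    (h : ∀ H : Finset X, IsSearch F H (findsol ε H) (c (remaining F H)) (q (remaining F H)))
    (r d : ℝ≥0∞) {g : Finset X → ℝ≥0∞} (hg : g (solutions F) = 0) (hd : ∀ S, g S ≤ d)
    (n : ℕ) {H : Finset X} (hH : H ⊆ solutions F) (hn : remaining F H < n) :
    (findallLoop ε n H).expect F r g ≤
      r * ∑ s ∈ Finset.range (remaining F H + 1), ENNReal.ofReal (c s) +
        (∑ s ∈ Finset.range (remaining F H), ENNReal.ofReal (q (s + 1))) * d := by
  induction n generalizing H with
  | zero => omega
  | succ n ih =>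
    rw [findallLoop, expect_bind]
    rcases hr : remaining F H with _ | k
    · have hHS : H = solutions F :=
        hH.antisymm (Finset.sdiff_eq_empty_iff_subset.1 (Finset.card_eq_zero.1 hr))
      have := (h H).expect_le r 0 0 (fun o => (match o with
        | some x => findallLoop ε n (insert x H)
        | none => .ret H : Alg X (Finset X)).expect F r g) ?_ ?_
      · rw [hr] at this
        refine this.trans (le_of_eq ?_)
        simp
      · intro x hx hxH
        refine absurd ?_ hxH
        rw [hHS]
        simp [solutions, hx]
      · simp [hHS, hg]
    -- Success leads to the bound for k remaining solutions; a wrong stop is charged at most `d`.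
    · have := (h H).expect_le r
        (r * ∑ s ∈ Finset.range (k + 1), ENNReal.ofReal (c s) +
          (∑ s ∈ Finset.range k, ENNReal.ofReal (q (s + 1))) * d) d (fun o => (match o with
        | some x => findallLoop ε n (insert x H)
        | none => .ret H : Alg X (Finset X)).expect F r g) ?_ ?_
      · rw [hr] at this
        refine this.trans (le_of_eq ?_)
        rw [Finset.sum_range_succ _ (k + 1),
          Finset.sum_range_succ (fun s => ENNReal.ofReal (q (s + 1))) k]
        ring
      · intro x hx hxH
        have hxS : x ∈ solutions F \ H := by simp [solutions, hx, hxH]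
        have hk : remaining F (insert x H) = k := by
          rw [remaining, Finset.sdiff_insert, Finset.card_erase_of_mem hxS]
          change remaining F H - 1 = k
          omega
        have := ih (H := insert x H)
          (Finset.insert_subset (Finset.sdiff_subset hxS) hH) (by omega)
        rwa [hk] at this
      · simp only [expect_ret]
        exact (hd H).trans le_add_self

end

/-! ### Sums over the rounds, and the final constants. -/

/-- Each term 1/(4(s+1)²) is at most 1/(s+1) - 1/(s+2). The subtracted 1/(M+1) is what makes the
induction work. -/
theorem sum_one_div_sq_le (M : ℕ) :
    ∑ s ∈ Finset.range M, (1 / (2 * ((s + 1 : ℕ) : ℝ))) ^ 2 ≤ 1 - 1 / ((M : ℝ) + 1) := by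
  induction M with
  | zero => simp
  | succ M ih =>
    rw [Finset.sum_range_succ]
    have : (1 / (2 * ((M + 1 : ℕ) : ℝ))) ^ 2 ≤
        1 / ((M : ℝ) + 1) - 1 / (((M + 1 : ℕ) : ℝ) + 1) := by
      push_cast
      rw [div_sub_div _ _ (by positivity) (by positivity), div_pow,
        div_le_div_iff₀ (by positivity) (by positivity)]
      have : (0 : ℝ) ≤ M := by positivity
      nlinarith
    linarith

theorem sum_one_div_sq_le_one (M : ℕ) :
    ∑ s ∈ Finset.range M, (1 / (2 * ((s + 1 : ℕ) : ℝ))) ^ 2 ≤ 1 :=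
  (sum_one_div_sq_le M).trans (by simp; positivity)

theorem sum_sqrt_div_le (N M : ℕ) :
    ∑ s ∈ Finset.range M, √((N : ℝ) / ((s + 1 : ℕ) : ℝ)) ≤ 2 * √((N : ℝ) * M) := by
  induction M with
  | zero => simp
  | succ M ih =>
    rw [Finset.sum_range_succ]
    rw [Real.sqrt_mul (by positivity)] at ih ⊢
    push_cast at ih ⊢
    rw [Real.sqrt_div (by positivity) ((M : ℝ) + 1), div_eq_mul_one_div]
    have := mul_le_mul_of_nonneg_left (one_div_sqrt_le M) (Real.sqrt_nonneg (N : ℝ))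
    linarith

/-- Rounding up costs at most 1, which is at most L/L₀ for L = lg ε⁻¹ ≥ L₀ = lg ε₀⁻¹ > 0. Only here
does the constant depend on ε₀. -/
theorem bcwzParam_le_mul (N : ℕ) {ε ε₀ : ℝ} (h0 : 0 < ε) (h : ε ≤ ε₀) (h1 : ε₀ < 1) :
    (bcwzParam N ε : ℝ) ≤ (1 + 1 / Real.logb 2 ε₀⁻¹) * Real.logb 2 ε⁻¹ := by
  have hε₀ : 0 < ε₀ := h0.trans_le h
  have hL₀ : 0 < Real.logb 2 ε₀⁻¹ := Real.logb_pos (by norm_num) ((one_lt_inv₀ hε₀).2 h1)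
  have hL : Real.logb 2 ε₀⁻¹ ≤ Real.logb 2 ε⁻¹ :=
    Real.logb_le_logb_of_le (by norm_num) (by positivity) (inv_anti₀ h0 h)
  have h2 : (bcwzParam N ε : ℝ) ≤ ⌈Real.logb 2 ε⁻¹⌉₊ := by exact_mod_cast min_le_left _ _
  have h3 := Nat.ceil_lt_add_one (hL₀.le.trans hL)
  have h4 : 1 ≤ 1 / Real.logb 2 ε₀⁻¹ * Real.logb 2 ε⁻¹ := by
    rw [one_div_mul_eq_div, one_le_div hL₀]
    exact hL
  linarith

section

variable (X : Type u) [Fintype X] [DecidableEq X] [Nonempty X] (F : X → Bool) {ε : ℝ}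

/-- Here 128 = 2 · 64 comes from ∑ 1/√s ≤ 2√M. The other constant is 88 = 64 + 12 + 12: BBHT and
BCWZ in the last round, and BCWZ in all the others together. -/
theorem expect_findall_le (h0 : 0 < ε) (h1 : ε < 1) (r d : ℝ≥0∞) {g : Finset X → ℝ≥0∞}
    (hg : g (solutions F) = 0) (hd : ∀ S, g S ≤ d) :
    (findall X ε).expect F r g ≤
      r * ENNReal.ofReal (128 * √((Fintype.card X : ℝ) * (solutions F).card) +
        88 * √((Fintype.card X : ℝ) * bcwzParam (Fintype.card X) ε)) + ENNReal.ofReal ε * d := by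
  set t := bcwzParam (Fintype.card X) ε with ht
  have ht0 : 0 < t := bcwzParam_pos Fintype.card_pos h0 h1
  have hM : remaining F ∅ = (solutions F).card := by rw [remaining, Finset.sdiff_empty]
  have key := expect_findallLoop_le F (ε := ε)
    (c := fun s => if s = 0 then 64 * √(Fintype.card X : ℝ) + 12 * √((Fintype.card X : ℝ) * t)
      else 64 * √((Fintype.card X : ℝ) / s) + (1 / (2 * s)) ^ 2 *
        (12 * √((Fintype.card X : ℝ) * t)))
    (q := fun s => if s = 0 then 1 else (1 / (2 * s)) ^ 2 * ε) ?_ r d hg hd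
    (Fintype.card X + 1) (Finset.empty_subset _) (Nat.lt_succ_of_le (remaining_le F ∅))
  · rw [← findall, hM] at key
    refine key.trans ?_
    rw [← ENNReal.ofReal_sum_of_nonneg, ← ENNReal.ofReal_sum_of_nonneg]
    · gcongr
      · rw [Finset.sum_range_succ']
        simp only [Nat.succ_ne_zero, if_false, if_true]
        rw [Finset.sum_add_distrib, ← Finset.mul_sum, ← Finset.sum_mul]
        have hA := sum_sqrt_div_le (Fintype.card X) (solutions F).card
        have hB := mul_le_mul_of_nonneg_right (sum_one_div_sq_le_one (solutions F).card)
          (show 0 ≤ 12 * √((Fintype.card X : ℝ) * t) by positivity)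
        have hC : √(Fintype.card X : ℝ) ≤ √((Fintype.card X : ℝ) * t) := by
          refine Real.sqrt_le_sqrt (le_mul_of_one_le_right (by positivity) ?_)
          exact_mod_cast ht0
        linarith
      · simp only [Nat.succ_ne_zero, if_false]
        rw [← Finset.sum_mul]
        exact mul_le_of_le_one_left h0.le (sum_one_div_sq_le_one _)
    · intro s _
      split_ifs <;> positivity
    · intro s _
      split_ifs <;> positivity
  · intro H
    rcases Nat.eq_zero_or_pos (remaining F H) with hr | hr
    · simp only [hr, if_true]
      exact isSearch_findsol_one F H h0 h1
    · simp only [hr.ne', if_false]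
      exact isSearch_findsol F H h0 h1 hr

end

end QuantumSearch

end

theorem theorem3 (ε₀ : ℝ) (hε₀ : ε₀ < 1) :
    ∃ C : ℝ, 0 < C ∧
      ∀ (X : Type u) [Fintype X] [DecidableEq X] [Nonempty X] (F : X → Bool) (N M : ℕ) (ε : ℝ),
        Fintype.card X = N → (QuantumSearch.solutions F).card = M → 0 < ε → ε ≤ ε₀ →
          (QuantumSearch.findall X ε).probNe F (QuantumSearch.solutions F) ≤ ENNReal.ofReal ε ∧
          (QuantumSearch.findall X ε).expectedCalls F ≤
            ENNReal.ofReal (C * (√((N : ℝ) * M) + √((N : ℝ) * Real.logb 2 ε⁻¹))) := by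
  -- For ε₀ ≤ 0 the claim is vacuous, but the constant must still be positive; this holds because a
  -- square root is never negative.
  refine ⟨128 + 88 * √(1 + 1 / Real.logb 2 ε₀⁻¹), by positivity, ?_⟩
  intro X _ _ _ F N M ε hN hM h0 hε
  subst hN hM
  constructor
  · rw [QuantumSearch.probNe_eq_expect]
    refine (QuantumSearch.expect_findall_le X F h0 (hε.trans_lt hε₀) 0 1 (by simp) ?_).trans
      (by simp)
    intro S
    split_ifs <;> simp
  · rw [QuantumSearch.expectedCalls_eq_expect]
    refine (QuantumSearch.expect_findall_le X F h0 (hε.trans_lt hε₀) 1 0 rfl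
      fun _ => le_rfl).trans ?_
    rw [mul_zero, add_zero, one_mul]
    refine ENNReal.ofReal_le_ofReal ?_
    have hlog : 0 < Real.logb 2 ε₀⁻¹ :=
      Real.logb_pos (by norm_num) ((one_lt_inv₀ (h0.trans_le hε)).2 hε₀)
    have ht : √((Fintype.card X : ℝ) * QuantumSearch.bcwzParam (Fintype.card X) ε) ≤
        √(1 + 1 / Real.logb 2 ε₀⁻¹) * √((Fintype.card X : ℝ) * Real.logb 2 ε⁻¹) := by
      rw [← Real.sqrt_mul (by positivity)]
      refine Real.sqrt_le_sqrt ?_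
      have := mul_le_mul_of_nonneg_left
        (QuantumSearch.bcwzParam_le_mul (Fintype.card X) h0 hε hε₀)
        (show (0 : ℝ) ≤ Fintype.card X by positivity)
      linarith
    have h1 : 0 ≤ √(1 + 1 / Real.logb 2 ε₀⁻¹) *
        √((Fintype.card X : ℝ) * (QuantumSearch.solutions F).card) := by positivity
    have h2 := Real.sqrt_nonneg ((Fintype.card X : ℝ) * Real.logb 2 ε⁻¹)
    linarith
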